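/- Let $n\ge 2$. For $0<N_1\le N_2$, an $(N_1,N_2)$-tube in $\mathbb R^n$ is a solid cylinder of radius $N_1$ and length $N_2$; its eccentricity is $N_2/N_1$ and its direction is $\pm u$, where $u$ is a unit vector spanning its axis. Directions are $\delta$-separated if $|u-u'|\ge\delta$ and $|u+u'|\ge\delta$ for any two distinct tubes of the family. For $1<r\le\infty$ (with $1/\infty=0$), say that the Kakeya maximal estimate with exponent $r$ holds in $\mathbb R^n$ if for every $\epsilon>0$ there is $A=A(n,r,\epsilon)$ such that $$\Big\|\sum_{T\in\Omega}1_T\Big\|_{L^r(\mathbb R^n)}\le A\,\delta^{-\epsilon}\Big(\sum_{T\in\Omega}|T|\Big)^{1/r}\delta^{\frac nr-(n-1)}$$ for every $\delta\in(0,1]$ and every finite family $\Omega$ of tubes of equal size, eccentricity $\delta^{-1}$ and $\delta$-separated directions. The Kakeya maximal operator conjecture in $\mathbb R^n$ says that this holds for all $\frac n{n-1}\le r\le\infty$. A real algebraic variety in $\mathbb R^n$ of degree at most $D$ is the common zero set of a set of real polynomials of degree at most $D$; its dimension is the Krull dimension of its coordinate ring $\mathbb R[x_1,\dots,x_n]/I(Z)$.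 For $K>0$, an $(R^{1/2},R)$-tube is tangent to $Z$ with constant $K$ if it is contained in the $KR^{1/2}$-neighbourhood of $Z$. For $\alpha\in\mathbb R$ let $(\mathrm{TT}_\alpha)$ be the following statement: there is $C$ such that for all $K>0$ and $\epsilon>0$ there is $A$ with $$\#\Omega\le A\,R^{\epsilon}\,D^{C}R^{\alpha}$$ for all $R\ge1$, all $D$, and all finite families $\Omega$ of $(R^{1/2},R)$-tubes contained in a ball $B_R\subset\mathbb R^n$ of radius $R$, with $R^{-1/2}$-separated directions, and all tangent with constant $K$ to one $(n-1)$-dimensional variety $Z$ of degree at most $D$. (So $C$ is independent of $D,R,K,\epsilon$, and $A$ is independent of $D,R,Z,\Omega$.) Proposition. (i) If $1<r\le\infty$, $\frac1r+\frac1{r'}=1$, and the Kakeya maximal estimate with exponent $r$ holds in $\mathbb R^n$, then $(\mathrm{TT}_\alpha)$ holds with $\alpha=n-1-\frac{r'}2$. (ii) Consequently, if the Kakeya maximal operator conjecture holds in $\mathbb R^n$, then so does the tangent-tube conjecture in $\mathbb R^n$, namely $(\mathrm{TT}_\alpha)$ with $\alpha=\frac{n-2}2$. -/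

import Mathlib

open MeasureTheory
open scoped ENNReal

/-- An `(N₁, N₂)`-tube in `ℝⁿ`: a solid cylinder of radius `N₁` and length `N₂`, given by its
centre and a unit vector spanning its axis. -/
structure Tube (n : ℕ) (N₁ N₂ : ℝ) where
  center : EuclideanSpace ℝ (Fin n)
  dir : EuclideanSpace ℝ (Fin n)
  norm_dir : ‖dir‖ = 1

/-- The solid cylinder: the component of `x - center` along the axis has length at most `N₂ / 2`,
and the component orthogonal to the axis has length at most `N₁`. -/
def Tube.carrier {n : ℕ} {N₁ N₂ : ℝ} (T : Tube n N₁ N₂) : Set (EuclideanSpace ℝ (Fin n)) :=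
  {x | |inner ℝ T.dir (x - T.center)| ≤ N₂ / 2 ∧
    ‖(x - T.center) - inner ℝ T.dir (x - T.center) • T.dir‖ ≤ N₁}

/-- Distinct tubes of the family have `δ`-separated directions. Directions are unoriented: `u` and
`-u` are the same direction. -/
def DirSeparated {n : ℕ} {N₁ N₂ : ℝ} (δ : ℝ) (Ω : Finset (Tube n N₁ N₂)) : Prop :=
  ∀ T ∈ Ω, ∀ T' ∈ Ω, T ≠ T' → δ ≤ ‖T.dir - T'.dir‖ ∧ δ ≤ ‖T.dir + T'.dir‖

/-- The Kakeya maximal estimate in `ℝⁿ` with exponent `r`, where `1 / ∞ = 0`: for all `ε > 0`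
there is a constant `A` such that
`‖∑_{T ∈ Ω} 1_T‖_r ≤ A δ^{-ε} (∑_{T ∈ Ω} |T|)^{1/r} δ^{n/r - (n-1)}`
for every family `Ω` of tubes of equal size, with eccentricity `δ⁻¹` and `δ`-separated
directions. -/
def KakeyaMaximalEstimate (n : ℕ) (r : ℝ≥0∞) : Prop :=
  ∀ ε : ℝ, 0 < ε → ∃ A : ℝ, 0 < A ∧
    ∀ δ N₁ N₂ : ℝ, 0 < N₁ → N₁ ≤ N₂ → δ = N₁ / N₂ →
    ∀ Ω : Finset (Tube n N₁ N₂), DirSeparated δ Ω →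
      eLpNorm (fun x => ∑ T ∈ Ω, T.carrier.indicator (fun _ => (1 : ℝ)) x) r volume ≤
        ENNReal.ofReal (A * δ ^ (-ε)) *
          (∑ T ∈ Ω, volume T.carrier) ^ (r⁻¹).toReal *
          ENNReal.ofReal (δ ^ ((n : ℝ) * (r⁻¹).toReal - ((n : ℝ) - 1)))

/-- The Kakeya maximal operator conjecture in `ℝⁿ`. -/
def KakeyaMaximalConjecture (n : ℕ) : Prop :=
  ∀ r : ℝ≥0∞, ENNReal.ofReal ((n : ℝ) / ((n : ℝ) - 1)) ≤ r → KakeyaMaximalEstimate n r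

/-- `Z ⊆ ℝⁿ` is a real algebraic variety of dimension `m` and degree at most `D`: it is the common
zero set of real polynomials of degree at most `D`, and its coordinate ring `ℝ[x₁, …, xₙ] / I(Z)`
has Krull dimension `m`. -/
def IsVariety {n : ℕ} (m D : ℕ) (Z : Set (EuclideanSpace ℝ (Fin n))) : Prop :=
  (∃ S : Set (MvPolynomial (Fin n) ℝ), (∀ p ∈ S, p.totalDegree ≤ D) ∧
    Z = {x | ∀ p ∈ S, MvPolynomial.eval (fun i => x i) p = 0}) ∧
  ringKrullDim (MvPolynomial (Fin n) ℝ ⧸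
    MvPolynomial.vanishingIdeal ℝ ((fun x : EuclideanSpace ℝ (Fin n) => fun i => x i) '' Z)) =
      (m : WithBot ℕ∞)

/-- An `(R^{1/2}, R)`-tube is tangent to `Z`, with constant `K`, if it is contained in the wall,
that is, in the `K R^{1/2}`-neighbourhood of `Z`. -/
def Tube.IsTangent {n : ℕ} {R : ℝ} (K : ℝ) (Z : Set (EuclideanSpace ℝ (Fin n)))
    (T : Tube n (√R) R) : Prop :=
  T.carrier ⊆ Metric.thickening (K * √R) Z

/-- The bound `#Ω ⪅ D^C R^α` (`C` independent of `D` and `R`) for all families `Ω` of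
`(R^{1/2}, R)`-tubes in a ball of radius `R` in `ℝⁿ`, with `R^{-1/2}`-separated directions, all of
them tangent to one `(n-1)`-dimensional variety of degree at most `D`. Here `X ⪅ Y` means that for
all `ε > 0` there is a constant `A` such that `X ≤ A R^ε Y`. -/
def TangentTubeBound (n : ℕ) (α : ℝ) : Prop :=
  ∃ C : ℕ, ∀ K : ℝ, 0 < K → ∀ ε : ℝ, 0 < ε → ∃ A : ℝ, 0 < A ∧
    ∀ R : ℝ, 1 ≤ R → ∀ D : ℕ,
    ∀ Z : Set (EuclideanSpace ℝ (Fin n)), IsVariety (n - 1) D Z →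
    ∀ x₀ : EuclideanSpace ℝ (Fin n),
    ∀ Ω : Finset (Tube n (√R) R), DirSeparated (√R)⁻¹ Ω →
      (∀ T ∈ Ω, T.carrier ⊆ Metric.closedBall x₀ R) →
      (∀ T ∈ Ω, T.IsTangent K Z) →
      (Ω.card : ℝ) ≤ A * R ^ ε * (D : ℝ) ^ C * R ^ α

/-- The tangent-tube conjecture in `ℝⁿ`. -/
def TangentTubeConjecture (n : ℕ) : Prop :=
  TangentTubeBound n (((n : ℝ) - 2) / 2)

/-! Let `W` be the part of the wall in the ball and `S` the total volume of the tubes. All tubes lie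
in `W`, so Hölder gives `S ≤ ‖∑ 1_T‖_r |W|^{1/r'}`. The Kakeya estimate turns this into `S ≤ X
S^{1/r} |W|^{1/r'}`, hence `S ≤ X^{r'} |W|` (`le_rpow_mul_of_le_mul_rpow`). Each tube has volume at
least a constant times `R^{(n+1)/2}`, so an upper bound for `|W|` bounds the number of tubes.

The volume bound `|W| ≤ A (D+2)^C R^{n-1/2}` (`exists_volume_wall_le`) comes from counting the cubes
of side `√R` that meet the zero set of one nonzero polynomial vanishing on `Z`. Such a cube has a
corner around which the polynomial, on a complex polydisc, is not nearly constant. These corners are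
counted by induction on the dimension (`card_not_nearConst_mul_le`): in one variable they must lie
near a root, and interpolation at roots of unity reduces near-constancy in `n + 1` variables to one
line and `D + 1` slices. The power `C` depends only on `n`. -/

/-- `F` does not vanish at `c` and varies by at most the factor `η` on the unit polydisc around
`c`. -/
def NearConst {n : ℕ} (η : ℝ) (F : (Fin n → ℂ) → ℂ) (c : Fin n → ℂ) : Prop :=
  F c ≠ 0 ∧ ∀ z, (∀ i, ‖z i - c i‖ ≤ 1) → ‖F z - F c‖ ≤ η * ‖F c‖

/-- `F` is a polynomial of degree at most `D` in each variable separately. -/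
def SepPoly {n : ℕ} (D : ℕ) (F : (Fin n → ℂ) → ℂ) : Prop :=
  ∀ i x, ∃ q : Polynomial ℂ, q.natDegree ≤ D ∧ ∀ t, F (Function.update x i t) = q.eval t

/-! ### Near-constancy of one-variable polynomials away from their roots -/

/-- Moving from `c` to `z` changes each factor by at most the relative amount `1 / m`; these errors
compound multiplicatively. -/
theorem norm_multiset_prod_sub_le {m : ℝ} (hm : 0 < m) (c z : ℂ) (hz : ‖z - c‖ ≤ 1)
    (s : Multiset ℂ) (hs : ∀ t ∈ s, m ≤ ‖c - t‖) :
    ‖(s.map (z - ·)).prod - (s.map (c - ·)).prod‖ ≤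
      ((1 + 1 / m) ^ s.card - 1) * ‖(s.map (c - ·)).prod‖ := by
  induction s using Multiset.induction_on with
  | empty => simp
  | cons t s ih =>
    have ih' := ih fun u hu => hs u (Multiset.mem_cons_of_mem hu)
    have ht := hs t (Multiset.mem_cons_self t s)
    simp only [Multiset.map_cons, Multiset.prod_cons, Multiset.card_cons, norm_mul]
    set P := (s.map (z - ·)).prod
    set Q := (s.map (c - ·)).prod
    set E := (1 + 1 / m) ^ s.card
    have hzc : ‖z - c‖ ≤ 1 / m * ‖c - t‖ := by
      refine hz.trans ?_
      rw [one_div, inv_mul_eq_div, le_div_iff₀ hm]; linarith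
    have hzt : ‖z - t‖ ≤ (1 + 1 / m) * ‖c - t‖ := by
      have := norm_add_le (z - c) (c - t)
      rw [sub_add_sub_cancel] at this
      linarith
    have h0 : (z - t) * P - (c - t) * Q = (z - t) * (P - Q) + (z - c) * Q := by ring
    rw [h0]
    refine (norm_add_le _ _).trans ?_
    rw [norm_mul, norm_mul]
    calc _ ≤ ((1 + 1 / m) * ‖c - t‖) * ((E - 1) * ‖Q‖) + (1 / m * ‖c - t‖) * ‖Q‖ := by
          gcongr
      _ = _ := by ring

/-- Compare with `exp` and use `exp y - 1 ≤ 2 y` for small `y ≥ 0`. Of the two spare powers of `D +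
2`, one absorbs the factor `D` and the other the factor `2`. -/
theorem one_add_pow_sub_one_le (D e : ℕ) :
    (1 + 1 / ((D : ℝ) + 2) ^ (e + 2)) ^ D - 1 ≤ (((D : ℝ) + 2) ^ e)⁻¹ := by
  set B : ℝ := (D : ℝ) + 2 with hB
  have hB2 : 2 ≤ B := by simp [hB]
  have hpos : 0 < B := by linarith
  have h1 : (1 + 1 / B ^ (e + 2)) ^ D ≤ Real.exp (D * (1 / B ^ (e + 2))) := by
    rw [Real.exp_nat_mul]
    gcongr
    rw [add_comm]
    exact Real.add_one_le_exp _
  have h2 : (D : ℝ) * (1 / B ^ (e + 2)) ≤ (B ^ e)⁻¹ / 2 := by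
    have : (D : ℝ) ≤ B := by simp [hB]
    calc (D : ℝ) * (1 / B ^ (e + 2)) ≤ B * (1 / B ^ (e + 2)) := by gcongr
      _ = (B ^ e)⁻¹ * (1 / B) := by rw [pow_add]; field_simp
      _ ≤ (B ^ e)⁻¹ * (1 / 2) := by gcongr
      _ = _ := by ring
  have h3 : (B ^ e)⁻¹ ≤ 1 := inv_le_one_of_one_le₀ (one_le_pow₀ (by linarith))
  have h4 : 0 ≤ (D : ℝ) * (1 / B ^ (e + 2)) := by positivity
  have h5 := Real.abs_exp_sub_one_le (x := (D : ℝ) * (1 / B ^ (e + 2)))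
    (by rw [abs_of_nonneg h4]; linarith)
  rw [abs_of_nonneg h4] at h5
  linarith [le_abs_self (Real.exp (D * (1 / B ^ (e + 2))) - 1)]

theorem polynomial_near_const {D : ℕ} (e : ℕ) {q : Polynomial ℂ} (hq : q ≠ 0)
    (hD : q.natDegree ≤ D) (c : ℂ)
    (hr : ∀ t ∈ q.roots, ((D : ℝ) + 2) ^ (e + 2) ≤ ‖c - t‖) :
    q.eval c ≠ 0 ∧ ∀ z, ‖z - c‖ ≤ 1 →
      ‖q.eval z - q.eval c‖ ≤ (((D : ℝ) + 2) ^ e)⁻¹ * ‖q.eval c‖ := by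
  have hB : (0 : ℝ) < ((D : ℝ) + 2) ^ (e + 2) := by positivity
  refine ⟨fun h => ?_, fun z hz => ?_⟩
  · have := hr c ((Polynomial.mem_roots hq).2 h)
    simp only [sub_self, norm_zero] at this
    linarith
  · have hs := IsAlgClosed.splits q
    rw [hs.eval_eq_prod_roots z, hs.eval_eq_prod_roots c, ← mul_sub, norm_mul, norm_mul]
    have h1 := norm_multiset_prod_sub_le hB c z hz q.roots hr
    have hcard : q.roots.card ≤ D := (Polynomial.card_roots' q).trans hD
    have h2 : (1 + 1 / ((D : ℝ) + 2) ^ (e + 2)) ^ q.roots.card - 1 ≤ (((D : ℝ) + 2) ^ e)⁻¹ := by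
      refine le_trans ?_ (one_add_pow_sub_one_le D e)
      have : (1 : ℝ) ≤ 1 + 1 / ((D : ℝ) + 2) ^ (e + 2) := by
        have : 0 < 1 / ((D : ℝ) + 2) ^ (e + 2) := by positivity
        linarith
      gcongr
    calc _ ≤ ‖q.leadingCoeff‖ * ((((D : ℝ) + 2) ^ e)⁻¹ *
          ‖(q.roots.map (c - ·)).prod‖) := by
          gcongr
          exact h1.trans (by gcongr)
      _ = _ := by ring

theorem card_near_point_le (N m : ℕ) (t : ℂ) :
    (Finset.univ.filter fun k : Fin N => ‖((k : ℕ) : ℂ) - t‖ < m).card ≤ 2 * m := by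
  have h1 : ((Finset.univ.filter fun k : Fin N => ‖((k : ℕ) : ℂ) - t‖ < m)).card ≤
      (Finset.Ioo (⌊t.re⌋ - m) (⌊t.re⌋ + m + 1)).card := by
    refine Finset.card_le_card_of_injOn (fun k : Fin N => ((k : ℕ) : ℤ)) ?_ ?_
    · intro k hk
      simp only [Finset.coe_filter, Finset.mem_univ, true_and, Set.mem_ofPred_eq] at hk
      have h2 := (Complex.abs_re_le_norm (((k : ℕ) : ℂ) - t)).trans_lt hk
      simp only [Complex.sub_re, Complex.natCast_re] at h2
      rw [abs_lt] at h2
      have h3 := Int.floor_le t.re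
      have h4 := Int.lt_floor_add_one t.re
      simp only [Finset.coe_Ioo, Set.mem_Ioo]
      constructor
      · have : ((⌊t.re⌋ - m : ℤ) : ℝ) < ((k : ℕ) : ℤ) := by push_cast; linarith
        exact_mod_cast this
      · have : (((k : ℕ) : ℤ) : ℝ) < ((⌊t.re⌋ + m + 1 : ℤ) : ℝ) := by push_cast; linarith
        exact_mod_cast this
    · intro a _ b _ hab
      simpa [Fin.ext_iff] using hab
  refine h1.trans ?_
  rw [Int.card_Ioo]
  omega

-- By `polynomial_near_const` a bad integer is close to one of at most `D` roots, and each root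
-- spoils at most `2 (D + 2)^(e + 2)` integers.
open Classical in
theorem card_bad_line {D : ℕ} (e N : ℕ) {q : Polynomial ℂ} (hq : q ≠ 0) (hD : q.natDegree ≤ D) :
    (Finset.univ.filter fun k : Fin N => ¬ (q.eval ((k : ℕ) : ℂ) ≠ 0 ∧
      ∀ z, ‖z - ((k : ℕ) : ℂ)‖ ≤ 1 → ‖q.eval z - q.eval ((k : ℕ) : ℂ)‖ ≤
        (((D : ℝ) + 2) ^ e)⁻¹ * ‖q.eval ((k : ℕ) : ℂ)‖)).card ≤ (D + 2) ^ (e + 4) := by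
  have hsub : (Finset.univ.filter fun k : Fin N => ¬ (q.eval ((k : ℕ) : ℂ) ≠ 0 ∧
      ∀ z, ‖z - ((k : ℕ) : ℂ)‖ ≤ 1 → ‖q.eval z - q.eval ((k : ℕ) : ℂ)‖ ≤
        (((D : ℝ) + 2) ^ e)⁻¹ * ‖q.eval ((k : ℕ) : ℂ)‖)) ⊆
      q.roots.toFinset.biUnion fun t =>
        Finset.univ.filter fun k : Fin N => ‖((k : ℕ) : ℂ) - t‖ < ((D + 2) ^ (e + 2) : ℕ) := by
    intro k hk
    simp only [Finset.mem_filter, Finset.mem_univ, true_and] at hk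
    by_contra hcon
    refine hk (polynomial_near_const e hq hD _ fun t ht => ?_)
    by_contra hlt
    refine hcon ?_
    simp only [Finset.mem_biUnion, Multiset.mem_toFinset, Finset.mem_filter, Finset.mem_univ,
      true_and]
    exact ⟨t, ht, by push_cast; linarith⟩
  refine (Finset.card_le_card hsub).trans ?_
  refine (Finset.card_biUnion_le_card_mul _ _ _ fun t _ => card_near_point_le N _ t).trans ?_
  have h1 : q.roots.toFinset.card ≤ D :=
    (Multiset.toFinset_card_le _).trans ((Polynomial.card_roots' q).trans hD)
  calc _ ≤ D * (2 * (D + 2) ^ (e + 2)) := by gcongr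
    _ = (2 * D) * (D + 2) ^ (e + 2) := by ring
    _ ≤ (D + 2) ^ 2 * (D + 2) ^ (e + 2) := by gcongr; nlinarith
    _ = _ := by ring

/-! ### Interpolation at roots of unity -/

/-- Orthogonality of the characters of `ℤ/N`: only the term `j = i` survives the sum over `a`. -/
theorem sum_rootsOfUnity_kernel {N : ℕ} {ω : ℂ} (hω : IsPrimitiveRoot ω N) {i : ℕ}
    (hi : i < N) (z : ℂ) :
    ∑ a ∈ Finset.range N, (ω ^ a) ^ i * ∑ j ∈ Finset.range N, z ^ j * (ω ^ a)⁻¹ ^ j =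
      N * z ^ i := by
  have hω0 : ω ≠ 0 := hω.ne_zero (by omega)
  have hgeom : ∀ j ∈ Finset.range N,
      ∑ a ∈ Finset.range N, (ω ^ a) ^ i * (z ^ j * (ω ^ a)⁻¹ ^ j) =
        if j = i then (N : ℂ) * z ^ i else 0 := by
    intro j hj
    rw [Finset.mem_range] at hj
    have hterm : ∀ a, (ω ^ a) ^ i * (z ^ j * (ω ^ a)⁻¹ ^ j) = z ^ j * (ω ^ i / ω ^ j) ^ a := by
      intro a
      rw [div_pow, ← pow_mul, ← pow_mul, inv_pow, ← pow_mul, ← pow_mul, mul_comm i a,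
        mul_comm j a]
      ring
    simp_rw [hterm, ← Finset.mul_sum]
    split_ifs with h
    · subst h
      rw [div_self (pow_ne_zero _ hω0)]
      simp [mul_comm]
    · have hne : ω ^ i / ω ^ j ≠ 1 := by
        rw [Ne, div_eq_one_iff_eq (pow_ne_zero _ hω0)]
        exact fun hh => h (hω.pow_inj hj hi hh.symm)
      rw [geom_sum_eq hne, div_pow, ← pow_mul, ← pow_mul, mul_comm i, mul_comm j, pow_mul,
        pow_mul, hω.pow_eq_one]
      simp
  simp_rw [Finset.mul_sum]
  rw [Finset.sum_comm, Finset.sum_congr rfl hgeom]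
  simp [hi]

theorem eval_eq_rootsOfUnity {D : ℕ} {ω : ℂ} (hω : IsPrimitiveRoot ω (D + 1))
    {q : Polynomial ℂ} (hq : q.natDegree ≤ D) (z : ℂ) :
    ((D + 1 : ℕ) : ℂ) * q.eval z = ∑ a ∈ Finset.range (D + 1), q.eval (ω ^ a) *
      ∑ j ∈ Finset.range (D + 1), z ^ j * (ω ^ a)⁻¹ ^ j := by
  have h1 := fun w : ℂ => Polynomial.eval_eq_sum_range' (Nat.lt_succ_of_le hq) w
  simp_rw [h1, Finset.sum_mul]
  rw [Finset.sum_comm, Finset.mul_sum]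
  refine Finset.sum_congr rfl fun i hi => ?_
  simp_rw [mul_assoc]
  rw [← Finset.mul_sum, sum_rootsOfUnity_kernel hω (Finset.mem_range.1 hi)]
  ring

/-- On the unit disc every interpolation kernel is a sum of `D + 1` terms of norm at most `1`.
Finitely many nodes thus control the whole disc, at the price of a factor `D + 1`. -/
theorem norm_eval_sub_le_of_rootsOfUnity {D : ℕ} {ω : ℂ} (hω : IsPrimitiveRoot ω (D + 1))
    {q : Polynomial ℂ} (hq : q.natDegree ≤ D) (c v : ℂ) {h : ℝ}
    (hh : ∀ a ∈ Finset.range (D + 1), ‖q.eval (c + ω ^ a) - v‖ ≤ h) (z : ℂ)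
    (hz : ‖z - c‖ ≤ 1) : ‖q.eval z - v‖ ≤ (D + 1) * h := by
  have h0 : 0 ≤ h := (norm_nonneg _).trans (hh 0 (by simp))
  set Q : Polynomial ℂ := q.comp (Polynomial.X + Polynomial.C c) - Polynomial.C v with hQ
  have hQD : Q.natDegree ≤ D := by
    rw [hQ, Polynomial.natDegree_sub_C, Polynomial.natDegree_comp]
    simpa using hq
  have hQe : ∀ w, Q.eval w = q.eval (c + w) - v := by
    intro w; simp [hQ, add_comm]
  have hn : ‖ω‖ = 1 := hω.norm'_eq_one (by omega)
  have key := eval_eq_rootsOfUnity hω hQD (z - c)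
  rw [hQe, add_sub_cancel] at key
  have h2 : ((D : ℝ) + 1) * ‖q.eval z - v‖ ≤ ((D : ℝ) + 1) * ((D + 1) * h) := by
    calc ((D : ℝ) + 1) * ‖q.eval z - v‖ = ‖((D + 1 : ℕ) : ℂ) * (q.eval z - v)‖ := by
          rw [norm_mul, Complex.norm_natCast]; push_cast; rfl
      _ ≤ ∑ a ∈ Finset.range (D + 1), h * (D + 1) := by
          rw [key]
          refine (norm_sum_le _ _).trans (Finset.sum_le_sum fun a ha => ?_)
          rw [norm_mul, hQe]
          refine mul_le_mul (hh a ha) ?_ (norm_nonneg _) h0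
          refine (norm_sum_le _ _).trans ?_
          calc _ ≤ ∑ j ∈ Finset.range (D + 1), (1 : ℝ) := by
                refine Finset.sum_le_sum fun j _ => ?_
                rw [norm_mul, norm_pow, norm_pow, norm_inv, norm_pow, hn]
                simpa using pow_le_one₀ (norm_nonneg _) hz
            _ = _ := by simp
      _ = _ := by rw [Finset.sum_const, Finset.card_range, nsmul_eq_mul]; push_cast; ring
  exact le_of_mul_le_mul_left h2 (by positivity)

/-! ### Counting bad lattice points by induction on the dimension -/

theorem SepPoly.cons {n D : ℕ} {F : (Fin (n + 1) → ℂ) → ℂ} (hF : SepPoly D F) (t : ℂ) :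
    SepPoly D fun x : Fin n → ℂ => F (Fin.cons t x) := by
  intro i x
  obtain ⟨q, hq, h⟩ := hF i.succ (Fin.cons t x)
  refine ⟨q, hq, fun s => ?_⟩
  rw [← h, ← Fin.cons_update]

theorem SepPoly.exists_head {n D : ℕ} {F : (Fin (n + 1) → ℂ) → ℂ} (hF : SepPoly D F)
    (x : Fin n → ℂ) :
    ∃ q : Polynomial ℂ, q.natDegree ≤ D ∧ ∀ t, F (Fin.cons t x) = q.eval t := by
  obtain ⟨q, hq, h⟩ := hF 0 (Fin.cons 0 x)
  refine ⟨q, hq, fun s => ?_⟩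
  rw [← h, Fin.update_cons_zero]

open Classical in
theorem card_filter_cons {n N : ℕ} (P : Fin N → (Fin n → Fin N) → Prop) :
    (Finset.univ.filter fun k : Fin (n + 1) → Fin N => P (k 0) (Fin.tail k)).card =
      ∑ a : Fin N, (Finset.univ.filter fun k : Fin n → Fin N => P a k).card := by
  simp_rw [Finset.card_filter]
  rw [← Equiv.sum_comp (Fin.consEquiv fun _ => Fin N), Fintype.sum_prod_type]
  simp [Fin.consEquiv]

open Classical in
theorem card_filter_cons' {n N : ℕ} (P : Fin N → (Fin n → Fin N) → Prop) :
    (Finset.univ.filter fun k : Fin (n + 1) → Fin N => P (k 0) (Fin.tail k)).card =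
      ∑ k : Fin n → Fin N, (Finset.univ.filter fun a : Fin N => P a k).card := by
  rw [card_filter_cons]
  simp_rw [Finset.card_filter]
  rw [Finset.sum_comm]

/-- The point of `ℂⁿ` with the natural coordinates `k`. -/
def latticePoint {n N : ℕ} (k : Fin n → Fin N) : Fin n → ℂ := fun i => ((k i : ℕ) : ℂ)

theorem latticePoint_eq_cons {n N : ℕ} (k : Fin (n + 1) → Fin N) :
    latticePoint k = Fin.cons ((k 0 : ℕ) : ℂ) (latticePoint (Fin.tail k)) := by
  ext i
  refine Fin.cases ?_ (fun j => ?_) i <;> simp [latticePoint, Fin.tail]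

/-- At a node `c + ω ^ a`, moving along the line costs `η ‖v‖` and moving inside the slice costs `2
η ‖v‖`. Interpolating in the first variable, with the others fixed, multiplies `3 η` by `D + 1`;
since `3 (D + 1) ≤ (D + 2)^2`, two powers are lost. -/
theorem nearConst_cons {n D e : ℕ} {F : (Fin (n + 1) → ℂ) → ℂ} (hF : SepPoly D F) {ω : ℂ}
    (hω : IsPrimitiveRoot ω (D + 1)) (c : ℂ) (w : Fin n → ℂ) (h0 : F (Fin.cons c w) ≠ 0)
    (h1 : ∀ t, ‖t - c‖ ≤ 1 → ‖F (Fin.cons t w) - F (Fin.cons c w)‖ ≤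
      (((D : ℝ) + 2) ^ (e + 2))⁻¹ * ‖F (Fin.cons c w)‖)
    (h2 : ∀ a ∈ Finset.range (D + 1), NearConst (((D : ℝ) + 2) ^ (e + 2))⁻¹
      (fun x : Fin n → ℂ => F (Fin.cons (c + ω ^ a) x)) w) :
    NearConst (((D : ℝ) + 2) ^ e)⁻¹ F (Fin.cons c w) := by
  refine ⟨h0, fun z hz => ?_⟩
  set v := F (Fin.cons c w) with hv
  set η : ℝ := (((D : ℝ) + 2) ^ (e + 2))⁻¹ with hη
  have hη0 : 0 ≤ η := by positivity
  have hη1 : η ≤ 1 := inv_le_one_of_one_le₀ (one_le_pow₀ (by linarith [D.cast_nonneg (α := ℝ)]))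
  have hn : ‖ω‖ = 1 := hω.norm'_eq_one (by omega)
  obtain ⟨q, hqD, hq⟩ := hF.exists_head (Fin.tail z)
  have hFz : F z = q.eval (z 0) := by rw [← hq, Fin.cons_self_tail]
  have hnodes : ∀ a ∈ Finset.range (D + 1), ‖q.eval (c + ω ^ a) - v‖ ≤ 3 * η * ‖v‖ := by
    intro a ha
    rw [← hq]
    have h3 := (h2 a ha).2 (Fin.tail z) (fun i => by simpa [Fin.tail] using hz i.succ)
    have h4 := h1 (c + ω ^ a) (by simp [hn])
    have h5 : ‖F (Fin.cons (c + ω ^ a) w)‖ ≤ 2 * ‖v‖ := by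
      have := norm_sub_norm_le (F (Fin.cons (c + ω ^ a) w)) v
      nlinarith [norm_nonneg v]
    have h6 := norm_sub_le_norm_sub_add_norm_sub (F (Fin.cons (c + ω ^ a) (Fin.tail z)))
      (F (Fin.cons (c + ω ^ a) w)) v
    have h7 := mul_le_mul_of_nonneg_left h5 hη0
    linarith
  have h8 := norm_eval_sub_le_of_rootsOfUnity hω hqD c v hnodes (z 0) (by simpa using hz 0)
  rw [hFz]
  refine h8.trans ?_
  have h9 : ((D : ℝ) + 1) * (3 * η) ≤ (((D : ℝ) + 2) ^ e)⁻¹ := by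
    rw [hη, pow_add, mul_inv]
    have : ((D : ℝ) + 1) * 3 * (((D : ℝ) + 2) ^ 2)⁻¹ ≤ 1 := by
      rw [← div_eq_mul_inv, div_le_one (by positivity)]
      have : (D : ℝ) ≤ D ^ 2 := by exact_mod_cast Nat.le_self_pow two_ne_zero D
      nlinarith
    calc _ = (((D : ℝ) + 2) ^ e)⁻¹ * (((D : ℝ) + 1) * 3 * (((D : ℝ) + 2) ^ 2)⁻¹) := by ring
      _ ≤ (((D : ℝ) + 2) ^ e)⁻¹ * 1 := by gcongr
      _ = _ := mul_one _
  calc _ = (((D : ℝ) + 1) * (3 * η)) * ‖v‖ := by ring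
    _ ≤ _ := by gcongr

-- The statement is needed for every `e` because each dimension loses two powers in
-- `nearConst_cons`. The factor `N` on the left avoids the exponent `n - 1` when `n = 0`.
open Classical in
theorem card_not_nearConst_mul_le (n : ℕ) : ∀ e : ℕ, ∃ C : ℕ, ∀ (D N : ℕ)
    (F : (Fin n → ℂ) → ℂ), SepPoly D F → (∃ x, F x ≠ 0) →
    (Finset.univ.filter fun k : Fin n → Fin N =>
      ¬ NearConst (((D : ℝ) + 2) ^ e)⁻¹ F (latticePoint k)).card * N ≤ (D + 2) ^ C * N ^ n := by
  induction n with
  | zero =>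
    refine fun e => ⟨0, fun D N F _ ⟨x, hx⟩ => ?_⟩
    have : (Finset.univ.filter fun k : Fin 0 → Fin N =>
        ¬ NearConst (((D : ℝ) + 2) ^ e)⁻¹ F (latticePoint k)) = ∅ := by
      refine Finset.filter_eq_empty_iff.2 fun k _ => not_not.2 ⟨?_, fun z _ => ?_⟩
      · rwa [Subsingleton.elim (latticePoint k) x]
      · rw [Subsingleton.elim z (latticePoint k), sub_self, norm_zero]
        positivity
    rw [this]
    simp
  | succ n ih =>
    intro e
    obtain ⟨C, hC⟩ := ih (e + 2)
    refine ⟨C + e + 8, fun D N F hF ⟨x, hx⟩ => ?_⟩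
    set B : ℕ := D + 2 with hB
    set η : ℝ := (((D : ℝ) + 2) ^ (e + 2))⁻¹ with hη
    obtain ⟨ω, hω⟩ : ∃ ω : ℂ, IsPrimitiveRoot ω (D + 1) :=
      ⟨_, Complex.isPrimitiveRoot_exp (D + 1) (by omega)⟩
    let G : ℂ → (Fin n → ℂ) → ℂ := fun t y => F (Fin.cons t y)
    have hG : ∀ t, SepPoly D (G t) := fun t => hF.cons t
    have hx' : G (x 0) (Fin.tail x) ≠ 0 := by
      simpa only [G, Fin.cons_self_tail] using hx
    -- Identically vanishing slices are declared harmless here, so that the bound holds for every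
    -- `t`; they are excluded through `Q` instead.
    let Bad : ℂ → (Fin n → Fin N) → Prop := fun t k =>
      (∃ y, G t y ≠ 0) ∧ ¬ NearConst η (G t) (latticePoint k)
    have hBad : ∀ t, (Finset.univ.filter fun k => Bad t k).card * N ≤ B ^ C * N ^ n := by
      intro t
      by_cases ht : ∃ y, G t y ≠ 0
      · simpa only [Bad, ht, true_and] using hC D N (G t) (hG t) ht
      · simp [Bad, ht]
    -- `P` collects failures inside slices, counted in `k` for fixed `a`; `Q` collects failures in
    -- the first variable, counted in `a` for fixed `k`. The slice at `x 0` is included in `P` to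
    -- ensure that the line through `latticePoint k` is not identically zero. The last clause of `Q`
    -- tests at the single point `Fin.tail x` whether a node slice may vanish.
    obtain ⟨P, hPdef⟩ : ∃ P : Fin N → (Fin n → Fin N) → Prop, P = fun (a : Fin N) k =>
      Bad (x 0) k ∨ ∃ b ∈ Finset.range (D + 1), Bad (((a : ℕ) : ℂ) + ω ^ b) k := ⟨_, rfl⟩
    obtain ⟨Q, hQdef⟩ : ∃ Q : Fin N → (Fin n → Fin N) → Prop, Q = fun (a : Fin N) k =>
      ((∃ t, G t (latticePoint k) ≠ 0) ∧ ¬ (G ((a : ℕ) : ℂ) (latticePoint k) ≠ 0 ∧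
        ∀ z, ‖z - ((a : ℕ) : ℂ)‖ ≤ 1 → ‖G z (latticePoint k) - G ((a : ℕ) : ℂ) (latticePoint k)‖ ≤
          η * ‖G ((a : ℕ) : ℂ) (latticePoint k)‖)) ∨
      ∃ b ∈ Finset.range (D + 1), G (((a : ℕ) : ℂ) + ω ^ b) (Fin.tail x) = 0 := ⟨_, rfl⟩
    have hsub : (Finset.univ.filter fun k : Fin (n + 1) → Fin N =>
        ¬ NearConst (((D : ℝ) + 2) ^ e)⁻¹ F (latticePoint k)) ⊆
        (Finset.univ.filter fun k : Fin (n + 1) → Fin N => P (k 0) (Fin.tail k)) ∪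
        (Finset.univ.filter fun k : Fin (n + 1) → Fin N => Q (k 0) (Fin.tail k)) := by
      intro k hk
      simp only [Finset.mem_filter, Finset.mem_univ, true_and, Finset.mem_union] at hk ⊢
      by_contra hcon
      rw [not_or] at hcon
      obtain ⟨hP, hQ⟩ := hcon
      simp only [hPdef, hQdef, not_or, not_and, not_exists] at hP hQ
      have h1 : ∃ t, G t (latticePoint (Fin.tail k)) ≠ 0 := by
        refine ⟨x 0, ?_⟩
        have := hP.1
        simp only [Bad, not_and, not_not] at this
        exact (this ⟨_, hx'⟩).1
      obtain ⟨h0, h2⟩ := Classical.byContradiction fun h =>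
        hQ.1 h1 fun h' h'' => h (And.intro h' h'')
      rw [latticePoint_eq_cons] at hk
      refine hk (nearConst_cons hF hω _ _ h0 h2 fun a ha => ?_)
      have := hP.2 a ha
      simp only [Bad, not_and, not_not] at this
      exact this ⟨_, hQ.2 a ha⟩
    have hPc : (Finset.univ.filter fun k : Fin (n + 1) → Fin N =>
        P (k 0) (Fin.tail k)).card * N ≤ (D + 2) * B ^ C * N ^ (n + 1) := by
      rw [card_filter_cons, Finset.sum_mul]
      calc _ ≤ ∑ a : Fin N, (D + 2) * (B ^ C * N ^ n) := by
            refine Finset.sum_le_sum fun a _ => ?_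
            have h1 : (Finset.univ.filter fun k => P a k) ⊆
                (Finset.univ.filter fun k => Bad (x 0) k) ∪
                (Finset.range (D + 1)).biUnion fun b =>
                  Finset.univ.filter fun k => Bad (((a : ℕ) : ℂ) + ω ^ b) k := by
              intro k hk
              simpa [hPdef] using hk
            have h2 := (Finset.card_le_card h1).trans (Finset.card_union_le _ _)
            have h3 : ((Finset.range (D + 1)).biUnion fun b =>
                Finset.univ.filter fun k => Bad (((a : ℕ) : ℂ) + ω ^ b) k).card * N ≤
                (D + 1) * (B ^ C * N ^ n) := by
              refine (Nat.mul_le_mul_right _ Finset.card_biUnion_le).trans ?_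
              rw [Finset.sum_mul]
              refine (Finset.sum_le_card_nsmul _ _ _ fun b _ => hBad _).trans ?_
              simp
            have h4 := hBad (x 0)
            calc _ ≤ _ := Nat.mul_le_mul_right N h2
              _ ≤ B ^ C * N ^ n + (D + 1) * (B ^ C * N ^ n) := by
                rw [add_mul]; exact add_le_add h4 h3
              _ = _ := by ring
        _ = _ := by simp; ring
    have hQc : (Finset.univ.filter fun k : Fin (n + 1) → Fin N =>
        Q (k 0) (Fin.tail k)).card ≤ (B ^ (e + 6) + (D + 1) * D) * N ^ n := by
      rw [card_filter_cons']
      calc _ ≤ ∑ k : Fin n → Fin N, (B ^ (e + 6) + (D + 1) * D) := by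
            refine Finset.sum_le_sum fun k _ => ?_
            have h1 : (Finset.univ.filter fun a => Q a k) ⊆
                (Finset.univ.filter fun a : Fin N =>
                  (∃ t, G t (latticePoint k) ≠ 0) ∧ ¬ (G ((a : ℕ) : ℂ) (latticePoint k) ≠ 0 ∧
                  ∀ z, ‖z - ((a : ℕ) : ℂ)‖ ≤ 1 →
                  ‖G z (latticePoint k) - G ((a : ℕ) : ℂ) (latticePoint k)‖ ≤
                    η * ‖G ((a : ℕ) : ℂ) (latticePoint k)‖)) ∪
                (Finset.range (D + 1)).biUnion fun b =>
                  Finset.univ.filter fun a : Fin N =>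
                    G (((a : ℕ) : ℂ) + ω ^ b) (Fin.tail x) = 0 := by
              intro a ha
              simp only [hQdef, Finset.mem_filter, Finset.mem_univ, true_and, Finset.mem_union,
                Finset.mem_biUnion] at ha ⊢
              exact ha
            refine (Finset.card_le_card h1).trans ((Finset.card_union_le _ _).trans ?_)
            refine add_le_add ?_ ?_
            · by_cases hk : ∃ t, G t (latticePoint k) ≠ 0
              · obtain ⟨q, hqD, hq⟩ := hF.exists_head (latticePoint k)
                have hq0 : q ≠ 0 := by
                  rintro rfl
                  obtain ⟨t, ht⟩ := hk
                  exact ht (by simpa using hq t)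
                have := card_bad_line (e + 2) N hq0 hqD
                refine le_trans (Finset.card_le_card fun a ha => ?_) this
                simp only [Finset.mem_filter, Finset.mem_univ, true_and, G, hq] at ha ⊢
                exact ha.2
              · simp [hk]
            -- The polynomial on the line through `x` is nonzero, so each of the `D + 1` node shifts
            -- rules out at most `D` values of `a`.
            · obtain ⟨q, hqD, hq⟩ := hF.exists_head (Fin.tail x)
              have hq0 : q ≠ 0 := by
                rintro rfl
                exact hx' (by simp only [G, hq, Polynomial.eval_zero])
              refine (Finset.card_biUnion_le_card_mul _ _ D fun b _ => ?_).trans (by simp)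
              refine le_trans ?_ ((Polynomial.card_roots' q).trans hqD)
              refine le_trans ?_ (Multiset.toFinset_card_le _)
              refine Finset.card_le_card_of_injOn
                (fun a : Fin N => ((a : ℕ) : ℂ) + ω ^ b) ?_ ?_
              · intro a ha
                simp only [Finset.coe_filter, Finset.mem_univ, true_and, Set.mem_ofPred_eq, G,
                  hq] at ha
                simpa [hq0] using ha
              · intro a _ a' _ haa
                simpa [Fin.ext_iff] using haa
        _ = _ := by simp; ring
    have hB2 : 2 ≤ B := by omega
    have hBpos : 0 < B := by omega
    calc _ ≤ _ := Nat.mul_le_mul_right N ((Finset.card_le_card hsub).trans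
            (Finset.card_union_le _ _))
      _ ≤ (D + 2) * B ^ C * N ^ (n + 1) + (B ^ (e + 6) + (D + 1) * D) * N ^ n * N := by
          rw [add_mul]
          gcongr
      _ = (B ^ (C + 1) + B ^ (e + 6) + (D + 1) * D) * N ^ (n + 1) := by
          rw [← hB]; ring
      _ ≤ B ^ (C + e + 8) * N ^ (n + 1) := by
          gcongr
          have h1 : B ^ (C + 1) ≤ B ^ (C + e + 6) := Nat.pow_le_pow_right hBpos (by omega)
          have h2 : B ^ (e + 6) ≤ B ^ (C + e + 6) := Nat.pow_le_pow_right hBpos (by omega)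
          have h3 : (D + 1) * D ≤ B ^ (C + e + 6) := by
            calc (D + 1) * D ≤ B ^ 2 := by rw [hB]; nlinarith
              _ ≤ _ := Nat.pow_le_pow_right hBpos (by omega)
          calc _ ≤ 2 ^ 2 * B ^ (C + e + 6) := by omega
            _ ≤ B ^ 2 * B ^ (C + e + 6) := by gcongr
            _ = _ := by ring

/-! ### Volume of the wall -/

theorem sepPoly_aeval {n D : ℕ} (p : MvPolynomial (Fin n) ℂ) (hp : p.totalDegree ≤ D)
    (a : Fin n → ℂ) (ρ : ℂ) :
    SepPoly D fun x => MvPolynomial.eval (fun i => a i + ρ * x i) p := by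
  intro i x
  refine ⟨MvPolynomial.aeval (fun j => Polynomial.C (a j) + Polynomial.C ρ *
    (if j = i then Polynomial.X else Polynomial.C (x j))) p, ?_, fun t => ?_⟩
  · have := MvPolynomial.aeval_natDegree_le (n := 1) p hp (fun j => Polynomial.C (a j) +
      Polynomial.C ρ * (if j = i then Polynomial.X else Polynomial.C (x j))) fun j => by
        split_ifs <;> compute_degree!
    simpa using this
  · have key : ∀ r : MvPolynomial (Fin n) ℂ,
        MvPolynomial.eval (fun j => a j + ρ * Function.update x i t j) r =
        (MvPolynomial.aeval (fun j => Polynomial.C (a j) + Polynomial.C ρ *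
          (if j = i then Polynomial.X else Polynomial.C (x j))) r).eval t := by
      intro r
      induction r using MvPolynomial.induction_on with
      | C c => simp
      | add r s hr hs => simp only [map_add, Polynomial.eval_add, hr, hs]
      | mul_X r j hr =>
        simp only [map_mul, Polynomial.eval_mul, hr, MvPolynomial.eval_X, MvPolynomial.aeval_X]
        by_cases h : j = i
        · subst h; simp
        · simp [h]
    exact key p

/-- Among `Nⁿ` cubes of a grid, the zero set of a nonzero polynomial of degree at most `D` meets at
most `(D + 2)^C Nⁿ⁻¹`. -/
theorem exists_card_cubes_meeting_zeros_le (n : ℕ) : ∃ C : ℕ, ∀ (D N : ℕ)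
    (p : MvPolynomial (Fin n) ℝ), p ≠ 0 → p.totalDegree ≤ D → ∀ (a : Fin n → ℝ) (ρ : ℝ), 0 < ρ →
    ∃ S : Finset (Fin n → Fin N), S.card * N ≤ (D + 2) ^ C * N ^ n ∧
      ∀ z : Fin n → ℝ, MvPolynomial.eval z p = 0 → (∀ i, a i ≤ z i ∧ z i < a i + ρ * N) →
        ∃ k ∈ S, ∀ i, |z i - (a i + ρ * (k i : ℕ))| ≤ ρ := by
  classical
  -- With `e = 1` the allowed relative variation is `1 / (D + 2) < 1`, which excludes a zero in the
  -- polydisc; `e = 0` would allow one. `S` is the set of bad corners, and a zero is assigned to the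
  -- corner given by the floors of its rescaled coordinates.
  obtain ⟨C, hC⟩ := card_not_nearConst_mul_le n 1
  refine ⟨C, fun D N p hp hD a ρ hρ => ?_⟩
  set P : MvPolynomial (Fin n) ℂ := MvPolynomial.map (algebraMap ℝ ℂ) p with hP
  have hPD : P.totalDegree ≤ D := (Finset.sup_mono (MvPolynomial.support_map_subset _ _)).trans hD
  set F : (Fin n → ℂ) → ℂ := fun x => MvPolynomial.eval (fun i => (a i : ℂ) + ρ * x i) P with hF
  have hFr : ∀ y : Fin n → ℝ, F (fun i => (((y i - a i) / ρ : ℝ) : ℂ)) =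
      (MvPolynomial.eval y p : ℝ) := by
    intro y
    have : (fun i => (a i : ℂ) + ρ * (((y i - a i) / ρ : ℝ) : ℂ)) =
        fun i => algebraMap ℝ ℂ (y i) := by
      ext i
      have : (ρ : ℂ) ≠ 0 := by exact_mod_cast hρ.ne'
      push_cast
      simp only [Complex.coe_algebraMap]
      field_simp
      ring
    simp only [hF, this, hP, MvPolynomial.eval_map]
    exact MvPolynomial.eval₂_comp_left (algebraMap ℝ ℂ) (RingHom.id ℝ) y p |>.symm
  have hF0 : ∃ x, F x ≠ 0 := by
    by_contra! hcon
    refine hp (MvPolynomial.funext fun y => ?_)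
    have := hFr y
    rw [hcon] at this
    rw [map_zero]
    exact_mod_cast this.symm
  refine ⟨_, hC D N F (sepPoly_aeval P hPD _ _) hF0, fun z hz hza => ?_⟩
  have hdiv : ∀ i, 0 ≤ (z i - a i) / ρ := fun i => div_nonneg (by linarith [(hza i).1]) hρ.le
  have hlt : ∀ i, ⌊(z i - a i) / ρ⌋₊ < N := by
    intro i
    rw [Nat.floor_lt (hdiv i), div_lt_iff₀ hρ]
    linarith [(hza i).2]
  have hfl : ∀ i, |(z i - a i) / ρ - ⌊(z i - a i) / ρ⌋₊| ≤ 1 := by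
    intro i
    have h1 := Nat.floor_le (hdiv i)
    have h2 := Nat.lt_floor_add_one ((z i - a i) / ρ)
    rw [abs_le]; constructor <;> linarith
  refine ⟨fun i => ⟨⌊(z i - a i) / ρ⌋₊, hlt i⟩, ?_, fun i => ?_⟩
  · simp only [Finset.mem_filter, Finset.mem_univ, true_and]
    rintro ⟨h0, h1⟩
    have h2 := h1 (fun i => (((z i - a i) / ρ : ℝ) : ℂ)) fun i => by
      have := hfl i
      rw [← Real.norm_eq_abs, ← Complex.norm_real] at this
      simpa [latticePoint] using this
    rw [hFr, hz, Complex.ofReal_zero, zero_sub, norm_neg] at h2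
    have h3 := norm_pos_iff.2 h0
    have h4 : (((D : ℝ) + 2) ^ 1)⁻¹ < 1 :=
      inv_lt_one_of_one_lt₀ (by rw [pow_one]; linarith [D.cast_nonneg (α := ℝ)])
    nlinarith
  · have h1 : z i - (a i + ρ * (⌊(z i - a i) / ρ⌋₊ : ℕ)) =
        ρ * ((z i - a i) / ρ - ⌊(z i - a i) / ρ⌋₊) := by
      field_simp; ring
    simp only [h1, abs_mul, abs_of_pos hρ]
    nlinarith [hfl i]

theorem euclidean_norm_le_of_forall_le {n : ℕ} (x : EuclideanSpace ℝ (Fin n)) {ρ : ℝ} (hρ : 0 ≤ ρ)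
    (h : ∀ i, |x i| ≤ ρ) : ‖x‖ ≤ n * ρ := by
  rw [EuclideanSpace.norm_eq]
  refine Real.sqrt_le_iff.2 ⟨by positivity, ?_⟩
  calc ∑ i, ‖x i‖ ^ 2 ≤ ∑ i : Fin n, ρ ^ 2 :=
        Finset.sum_le_sum fun i _ => pow_le_pow_left₀ (norm_nonneg _) (h i) 2
    _ = n * ρ ^ 2 := by simp
    _ ≤ (n : ℝ) ^ 2 * ρ ^ 2 := by
        gcongr
        exact_mod_cast Nat.le_self_pow two_ne_zero n
    _ = _ := by ring

/-- The wall around the zero set of a nonzero polynomial, within a ball of radius `R`, has volume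
at most `A (D + 2)^C R^{n - 1/2}`. -/
theorem exists_volume_wall_le (n : ℕ) (hn : 1 ≤ n) : ∃ C : ℕ, ∀ K : ℝ, 0 < K → ∃ A : ℝ, 0 < A ∧
    ∀ R : ℝ, 1 ≤ R → ∀ (D : ℕ) (p : MvPolynomial (Fin n) ℝ), p ≠ 0 → p.totalDegree ≤ D →
    ∀ Z : Set (EuclideanSpace ℝ (Fin n)),
    (∀ z ∈ Z, MvPolynomial.eval (fun i => z i) p = 0) → ∀ x₀ : EuclideanSpace ℝ (Fin n),
    volume (Metric.thickening (K * √R) Z ∩ Metric.closedBall x₀ R) ≤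
      ENNReal.ofReal (A * ((D : ℝ) + 2) ^ C * R ^ ((n : ℝ) - 1 / 2)) := by
  obtain ⟨C, hC⟩ := exists_card_cubes_meeting_zeros_le n
  refine ⟨C, fun K hK => ?_⟩
  set V : ℝ := (volume (Metric.ball (0 : EuclideanSpace ℝ (Fin n)) 1)).toReal with hV
  have hVfin : volume (Metric.ball (0 : EuclideanSpace ℝ (Fin n)) 1) ≠ ∞ :=
    measure_ball_lt_top.ne
  have hVpos : 0 < V := ENNReal.toReal_pos (Metric.measure_ball_pos _ _ one_pos).ne' hVfin
  -- A zero within `K√R` of the ball lies within `(1 + K) R` of `x₀`, so about `2 (1 + K) √R` cubes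
  -- per side suffice. The extra `2` pays for rounding up to `N`, since `√R ≥ 1`.
  set L : ℝ := 2 * (1 + K) + 2 with hL
  have hLpos : 0 < L := by positivity
  have hKn : 0 < K + n := by positivity
  refine ⟨L ^ (n - 1) * ((K + n) ^ n * V), by positivity, ?_⟩
  intro R hR D p hp hD Z hZ x₀
  set ρ : ℝ := √R with hρdef
  have hρ1 : 1 ≤ ρ := Real.one_le_sqrt.2 hR
  have hρ : 0 < ρ := by linarith
  have hρR : ρ * ρ = R := Real.mul_self_sqrt (by linarith)
  set N : ℕ := ⌈2 * (1 + K) * ρ⌉₊ + 1 with hN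
  have hNle : (N : ℝ) ≤ L * ρ := by
    have := Nat.ceil_lt_add_one (a := 2 * (1 + K) * ρ) (by positivity)
    rw [hN, hL]; push_cast; nlinarith
  have hNge : 2 * (1 + K) * ρ < N := by
    have := Nat.le_ceil (2 * (1 + K) * ρ)
    rw [hN]; push_cast; linarith
  have hNpos : 0 < N := by omega
  obtain ⟨S, hS, hcov⟩ := hC D N p hp hD (fun i => x₀ i - (1 + K) * R) ρ hρ
  have hScard : (S.card : ℝ) ≤ ((D : ℝ) + 2) ^ C * (L * ρ) ^ (n - 1) := by
    have h1 : S.card ≤ (D + 2) ^ C * N ^ (n - 1) := by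
      refine Nat.le_of_mul_le_mul_right ?_ hNpos
      rw [mul_assoc, ← pow_succ, Nat.sub_add_cancel hn]
      exact hS
    calc (S.card : ℝ) ≤ (((D + 2) ^ C * N ^ (n - 1) : ℕ) : ℝ) := by exact_mod_cast h1
      _ = ((D : ℝ) + 2) ^ C * (N : ℝ) ^ (n - 1) := by push_cast; ring
      _ ≤ _ := by gcongr
  let ctr : (Fin n → Fin N) → EuclideanSpace ℝ (Fin n) := fun k =>
    WithLp.toLp 2 fun i => x₀ i - (1 + K) * R + ρ * (k i : ℕ)
  have hsub : Metric.thickening (K * ρ) Z ∩ Metric.closedBall x₀ R ⊆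
      ⋃ k ∈ S, Metric.closedBall (ctr k) ((K + n) * ρ) := by
    rintro x ⟨hx, hxR⟩
    obtain ⟨z, hzZ, hxz⟩ := Metric.mem_thickening_iff.1 hx
    rw [dist_eq_norm] at hxz
    rw [Metric.mem_closedBall, dist_eq_norm] at hxR
    have hzx : ‖z - x₀‖ < (1 + K) * R := by
      have h1 := norm_sub_le_norm_sub_add_norm_sub z x x₀
      rw [norm_sub_rev z x] at h1
      have : K * ρ ≤ K * R := by
        rw [← hρR]; gcongr; nlinarith
      linarith
    have hzi : ∀ i, |z i - x₀ i| < (1 + K) * R := fun i => by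
      simpa using (PiLp.norm_apply_le (z - x₀) i).trans_lt hzx
    obtain ⟨k, hkS, hk⟩ := hcov (fun i => z i) (hZ z hzZ) fun i => by
      have h1 := abs_lt.1 (hzi i)
      have h2 : 2 * (1 + K) * R ≤ ρ * N := by rw [← hρR]; nlinarith
      constructor <;> linarith
    simp only [Set.mem_iUnion]
    refine ⟨k, hkS, ?_⟩
    rw [Metric.mem_closedBall, dist_eq_norm]
    have h1 := euclidean_norm_le_of_forall_le (z - ctr k) hρ.le fun i => by
      simpa [ctr] using hk i
    have h2 := norm_sub_le_norm_sub_add_norm_sub x z (ctr k)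
    linarith
  have hball : ∀ k, volume (Metric.closedBall (ctr k) ((K + n) * ρ)) =
      ENNReal.ofReal (((K + n) * ρ) ^ n * V) := by
    intro k
    rw [Measure.addHaar_closedBall _ _ (by positivity), finrank_euclideanSpace_fin,
      ENNReal.ofReal_mul (by positivity), hV, ENNReal.ofReal_toReal hVfin]
  calc _ ≤ ∑ k ∈ S, volume (Metric.closedBall (ctr k) ((K + n) * ρ)) :=
        (measure_mono hsub).trans (measure_biUnion_finset_le _ _)
    _ = ENNReal.ofReal (S.card * (((K + n) * ρ) ^ n * V)) := by
        simp_rw [hball]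
        rw [Finset.sum_const, nsmul_eq_mul, ENNReal.ofReal_mul S.card.cast_nonneg,
          ENNReal.ofReal_natCast]
    _ ≤ _ := by
        refine ENNReal.ofReal_le_ofReal ?_
        -- About `ρ ^ (n - 1)` balls, each of volume about `ρ ^ n`.
        have hpow : R ^ ((n : ℝ) - 1 / 2) = ρ ^ (n - 1) * ρ ^ n := by
          rw [← pow_add, hρdef, Real.sqrt_eq_rpow, ← Real.rpow_natCast, ← Real.rpow_mul
            (by linarith)]
          congr 1
          rw [Nat.cast_add, Nat.cast_sub hn]; push_cast; ring
        calc _ ≤ (((D : ℝ) + 2) ^ C * (L * ρ) ^ (n - 1)) * (((K + n) * ρ) ^ n * V) := by gcongr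
          _ = _ := by rw [hpow, mul_pow, mul_pow]; ring

/-- If every defining polynomial were zero, `Z` would be the whole space, with vanishing ideal `⊥`
and coordinate ring of dimension `n` rather than `n - 1`. -/
theorem IsVariety.exists_polynomial {n D : ℕ} (hn : 1 ≤ n) {Z : Set (EuclideanSpace ℝ (Fin n))}
    (hZ : IsVariety (n - 1) D Z) :
    ∃ p : MvPolynomial (Fin n) ℝ, p ≠ 0 ∧ p.totalDegree ≤ D ∧
      ∀ z ∈ Z, MvPolynomial.eval (fun i => z i) p = 0 := by
  obtain ⟨⟨S, hSD, rfl⟩, hdim⟩ := hZ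
  by_cases h : ∃ p ∈ S, p ≠ 0
  · obtain ⟨p, hpS, hp⟩ := h
    exact ⟨p, hp, hSD p hpS, fun z hz => hz p hpS⟩
  · exfalso
    push Not at h
    have hbot : MvPolynomial.vanishingIdeal ℝ ((fun x : EuclideanSpace ℝ (Fin n) => fun i => x i) ''
        {x | ∀ p ∈ S, MvPolynomial.eval (fun i => x i) p = 0}) = ⊥ := by
      rw [eq_bot_iff]
      intro q hq
      rw [Ideal.mem_bot]
      refine MvPolynomial.funext fun y => ?_
      have := hq y ⟨WithLp.toLp 2 y, fun p hp => by simp [h p hp], rfl⟩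
      simpa [MvPolynomial.aeval_eq_eval] using this
    rw [hbot, ringKrullDim_eq_of_ringEquiv (RingEquiv.quotientBot _),
      MvPolynomial.ringKrullDim_of_isNoetherianRing, ringKrullDim_eq_zero_of_field] at hdim
    have h2 : ((n : ℕ) : WithBot ℕ∞) = ((n - 1 : ℕ) : WithBot ℕ∞) := by simpa using hdim
    have h3 : n = n - 1 := by exact_mod_cast h2
    omega

/-! ### Volume of tubes and Hölder's inequality -/

theorem Tube.isClosed_carrier {n : ℕ} {N₁ N₂ : ℝ} (T : Tube n N₁ N₂) : IsClosed T.carrier := by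
  have h : T.carrier = {x | |inner ℝ T.dir (x - T.center)| ≤ N₂ / 2} ∩
    {x | ‖(x - T.center) - inner ℝ T.dir (x - T.center) • T.dir‖ ≤ N₁} := rfl
  rw [h]
  refine IsClosed.inter (isClosed_le ?_ continuous_const) (isClosed_le ?_ continuous_const) <;>
    fun_prop

/-- A tube of radius `ρ ≥ 1` and length `ρ²` contains at least `ρ / 4` disjoint balls of radius
`ρ / 2` centred on its axis. -/
theorem Tube.le_volume_carrier {n : ℕ} {R : ℝ} (hR : 1 ≤ R) (T : Tube n (√R) R) :
    ENNReal.ofReal ((volume (Metric.ball (0 : EuclideanSpace ℝ (Fin n)) 1)).toReal * (1 / 2) ^ n / 4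
      * R ^ (((n : ℝ) + 1) / 2)) ≤ volume T.carrier := by
  set V : ℝ := (volume (Metric.ball (0 : EuclideanSpace ℝ (Fin n)) 1)).toReal with hV
  have hVfin : volume (Metric.ball (0 : EuclideanSpace ℝ (Fin n)) 1) ≠ ∞ :=
    measure_ball_lt_top.ne
  have hV0 : 0 ≤ V := ENNReal.toReal_nonneg
  generalize hρdef : √R = ρ at T
  have hρ1 : 1 ≤ ρ := hρdef ▸ Real.one_le_sqrt.2 hR
  have hρ : 0 < ρ := by linarith
  have hρR : ρ * ρ = R := hρdef ▸ Real.mul_self_sqrt (by linarith)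
  have huu : inner ℝ T.dir T.dir = (1 : ℝ) := by
    rw [real_inner_self_eq_norm_sq, T.norm_dir, one_pow]
  -- The balls march from the centre in one direction, at spacing `ρ`. For `j ≤ (ρ - 1) / 2` one has
  -- `j ρ + ρ / 2 ≤ ρ² / 2`, so the last ball still fits.
  set m : ℕ := ⌊(ρ - 1) / 2⌋₊ + 1 with hm
  have hm1 : ((m : ℝ) - 1) ≤ (ρ - 1) / 2 := by
    rw [hm]; push_cast
    linarith [Nat.floor_le (show 0 ≤ (ρ - 1) / 2 by linarith)]
  have hm2 : ρ / 4 ≤ m := by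
    have h1 := Nat.lt_floor_add_one ((ρ - 1) / 2)
    have h2 : (0 : ℝ) ≤ ⌊(ρ - 1) / 2⌋₊ := Nat.cast_nonneg _
    rw [hm]; push_cast; linarith
  let ctr : ℕ → EuclideanSpace ℝ (Fin n) := fun j => T.center + ((j : ℝ) * ρ) • T.dir
  have hdisj : ((Finset.range m : Finset ℕ) : Set ℕ).PairwiseDisjoint
      fun j => Metric.ball (ctr j) (ρ / 2) := by
    intro i _ j _ hij
    refine Metric.ball_disjoint_ball ?_
    have h1 : ctr i - ctr j = (((i : ℝ) - j) * ρ) • T.dir := by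
      simp only [ctr]; module
    rw [dist_eq_norm, h1, norm_smul, T.norm_dir, mul_one, norm_mul, Real.norm_of_nonneg hρ.le]
    have h2 : (1 : ℝ) ≤ ‖(i : ℝ) - j‖ := by
      have : (1 : ℤ) ≤ |(i : ℤ) - j| := Int.one_le_abs (by omega)
      rw [Real.norm_eq_abs]
      exact_mod_cast this
    nlinarith
  have hsub : (⋃ j ∈ Finset.range m, Metric.ball (ctr j) (ρ / 2)) ⊆ T.carrier := by
    refine Set.iUnion₂_subset fun j hj x hx => ?_
    have hj' : (j : ℝ) ≤ m - 1 := by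
      have : j + 1 ≤ m := Finset.mem_range.1 hj
      have : ((j + 1 : ℕ) : ℝ) ≤ m := by exact_mod_cast this
      push_cast at this; linarith
    rw [Metric.mem_ball, dist_eq_norm] at hx
    set y := x - ctr j with hy
    have hxy : x - T.center = y + ((j : ℝ) * ρ) • T.dir := by simp only [hy, ctr]; module
    have hin : inner ℝ T.dir (x - T.center) = inner ℝ T.dir y + (j : ℝ) * ρ := by
      rw [hxy, inner_add_right, real_inner_smul_right, huu, mul_one]
    have hyin : |inner ℝ T.dir y| ≤ ρ / 2 := by
      have := abs_real_inner_le_norm T.dir y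
      rw [T.norm_dir, one_mul] at this
      linarith
    constructor
    · rw [hin]
      refine (abs_add_le _ _).trans ?_
      rw [abs_of_nonneg (show 0 ≤ (j : ℝ) * ρ by positivity)]
      have : (j : ℝ) * ρ ≤ (ρ - 1) / 2 * ρ := by gcongr; linarith
      nlinarith
    · rw [hin, hxy]
      have h1 : y + ((j : ℝ) * ρ) • T.dir - (inner ℝ T.dir y + (j : ℝ) * ρ) • T.dir =
          y - inner ℝ T.dir y • T.dir := by module
      rw [h1]
      refine (norm_sub_le _ _).trans ?_
      rw [norm_smul, T.norm_dir, mul_one, Real.norm_eq_abs]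
      linarith
  have hball : ∀ j, volume (Metric.ball (ctr j) (ρ / 2)) = ENNReal.ofReal ((ρ / 2) ^ n * V) := by
    intro j
    rw [Measure.addHaar_ball_of_pos _ _ (by positivity), finrank_euclideanSpace_fin,
      ENNReal.ofReal_mul (by positivity), hV, ENNReal.ofReal_toReal hVfin]
  calc _ ≤ ENNReal.ofReal (m * ((ρ / 2) ^ n * V)) := by
        refine ENNReal.ofReal_le_ofReal ?_
        have hpow : R ^ (((n : ℝ) + 1) / 2) = ρ ^ n * ρ := by
          rw [← pow_succ, ← hρdef, Real.sqrt_eq_rpow, ← Real.rpow_natCast, ← Real.rpow_mul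
            (by linarith)]
          congr 1
          push_cast; ring
        calc _ = ρ / 4 * ((ρ / 2) ^ n * V) := by rw [hpow, div_pow, div_pow, one_pow]; ring
          _ ≤ _ := by gcongr
    _ = ∑ j ∈ Finset.range m, volume (Metric.ball (ctr j) (ρ / 2)) := by
        simp_rw [hball]
        rw [Finset.sum_const, Finset.card_range, nsmul_eq_mul,
          ENNReal.ofReal_mul m.cast_nonneg, ENNReal.ofReal_natCast]
    _ = volume (⋃ j ∈ Finset.range m, Metric.ball (ctr j) (ρ / 2)) :=
        (measure_biUnion_finset hdisj fun j _ => measurableSet_ball).symm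
    _ ≤ _ := measure_mono hsub

/-- Hölder's inequality for a sum of indicator functions of subsets of `W`. -/
theorem sum_measure_le_eLpNorm_mul {α ι : Type*} [MeasurableSpace α] {μ : Measure α}
    (s : Finset ι) {E : ι → Set α} (hE : ∀ i ∈ s, MeasurableSet (E i)) {W : Set α}
    (hW : ∀ i ∈ s, E i ⊆ W) {r : ℝ≥0∞} (hr : 1 ≤ r) :
    ∑ i ∈ s, μ (E i) ≤ eLpNorm (fun x => ∑ i ∈ s, (E i).indicator (fun _ => (1 : ℝ)) x) r μ *
      μ W ^ (1 - (r⁻¹).toReal) := by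
  set f : α → ℝ := fun x => ∑ i ∈ s, (E i).indicator (fun _ => (1 : ℝ)) x with hf
  have hmeas : Measurable f :=
    Finset.measurable_sum _ fun i hi => measurable_const.indicator (hE i hi)
  have hsupp : Function.support f ⊆ W := by
    intro x hx
    obtain ⟨i, hi, hix⟩ := Finset.exists_ne_zero_of_sum_ne_zero hx
    exact hW i hi (Set.mem_of_indicator_ne_zero hix)
  have h1 : eLpNorm f 1 μ = ∑ i ∈ s, μ (E i) := by
    rw [eLpNorm_one_eq_lintegral_enorm]
    have : ∀ x, ‖f x‖ₑ = ∑ i ∈ s, (E i).indicator (fun _ => (1 : ℝ≥0∞)) x := by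
      intro x
      have hnn : ∀ i ∈ s, 0 ≤ (E i).indicator (fun _ => (1 : ℝ)) x :=
        fun i _ => Set.indicator_nonneg (fun _ _ => zero_le_one) x
      rw [Real.enorm_of_nonneg (Finset.sum_nonneg hnn), ENNReal.ofReal_sum_of_nonneg hnn]
      refine Finset.sum_congr rfl fun i _ => ?_
      by_cases hx : x ∈ E i <;> simp [hx]
    simp_rw [this]
    rw [lintegral_finsetSum' _ fun i hi => (measurable_const.indicator (hE i hi)).aemeasurable]
    exact Finset.sum_congr rfl fun i hi => by rw [lintegral_indicator (hE i hi)]; simp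
  have h2 := eLpNorm_le_eLpNorm_mul_rpow_measure_univ (μ := μ.restrict W) hr
    hmeas.aestronglyMeasurable
  rw [eLpNorm_restrict_eq_of_support_subset hsupp, eLpNorm_restrict_eq_of_support_subset hsupp,
    Measure.restrict_apply_univ, h1] at h2
  simpa [ENNReal.toReal_inv] using h2

/-! ### From the maximal estimate to the tangent-tube bound -/

theorem eq_empty_of_zeros_of_totalDegree_eq_zero {n : ℕ} {p : MvPolynomial (Fin n) ℝ} (hp : p ≠ 0)
    (hD : p.totalDegree = 0) {Z : Set (EuclideanSpace ℝ (Fin n))}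
    (hZ : ∀ z ∈ Z, MvPolynomial.eval (fun i => z i) p = 0) : Z = ∅ := by
  refine Set.eq_empty_iff_forall_notMem.2 fun z hz => hp ?_
  have h := MvPolynomial.totalDegree_eq_zero_iff_eq_C.1 hD
  have h0 := hZ z hz
  rw [h, MvPolynomial.eval_C] at h0
  rw [h, h0, MvPolynomial.C_0]

theorem Tube.center_mem_carrier {n : ℕ} {N₁ N₂ : ℝ} (h₁ : 0 ≤ N₁) (h₂ : 0 ≤ N₂)
    (T : Tube n N₁ N₂) : T.center ∈ T.carrier := by
  constructor
  · simpa using by positivity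
  · simpa using h₁

/-- Divide by `s ^ a` and take `b`-th roots. With `a = 1 / r` and `b = 1 / r'` this absorbs the
total volume on the right of the Kakeya estimate. -/
theorem le_rpow_mul_of_le_mul_rpow {a b s X w : ℝ} (hb : 0 < b) (hab : a + b = 1) (hs : 0 ≤ s)
    (hX : 0 ≤ X) (hw : 0 ≤ w) (h : s ≤ X * s ^ a * w ^ b) : s ≤ X ^ b⁻¹ * w := by
  rcases hs.eq_or_lt with rfl | hs
  · positivity
  · have hsa : 0 < s ^ a := Real.rpow_pos_of_pos hs a
    have h1 : s ^ b ≤ X * w ^ b := by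
      refine le_of_mul_le_mul_left ?_ hsa
      rw [← Real.rpow_add hs, hab, Real.rpow_one]
      linarith
    have h2 := Real.rpow_le_rpow (Real.rpow_nonneg hs.le b) h1 (inv_nonneg.2 hb.le)
    rwa [Real.rpow_rpow_inv hs.le hb.ne', Real.mul_rpow hX (by positivity),
      Real.rpow_rpow_inv hw hb.ne'] at h2

theorem sqrt_inv_rpow {R : ℝ} (hR : 0 ≤ R) (t : ℝ) : (√R)⁻¹ ^ t = R ^ (-t / 2) := by
  rw [Real.sqrt_eq_rpow, ← Real.rpow_neg hR, ← Real.rpow_mul hR]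
  congr 1
  ring

theorem KakeyaMaximalEstimate.tangentTubeBound {n : ℕ} (hn : 1 ≤ n) {r r' : ℝ≥0∞} (hr : 1 < r)
    (hrr : r.HolderConjugate r') (hK : KakeyaMaximalEstimate n r) :
    TangentTubeBound n ((n : ℝ) - 1 - r'.toReal / 2) := by
  set a : ℝ := (r⁻¹).toReal with ha
  set b : ℝ := (r'⁻¹).toReal with hb
  have hr1 : r⁻¹ ≠ ∞ := ENNReal.inv_ne_top.2 (zero_lt_one.trans hr).ne'
  have hr'1 : r'⁻¹ ≠ ∞ := ENNReal.inv_ne_top.2 (ENNReal.HolderConjugate.ne_zero r' r)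
  have hr'top : r' ≠ ∞ := (ENNReal.HolderConjugate.lt_top_iff_one_lt r' r).2 hr |>.ne
  have hab : a + b = 1 := by
    rw [ha, hb, ← ENNReal.toReal_add hr1 hr'1, ENNReal.HolderConjugate.inv_add_inv_eq_one r r',
      ENNReal.toReal_one]
  have hb0 : 0 < b := ENNReal.toReal_pos (ENNReal.inv_ne_zero.2 hr'top) hr'1
  have hr'b : r'.toReal = b⁻¹ := by rw [hb, ENNReal.toReal_inv, inv_inv]
  obtain ⟨C, hC⟩ := exists_volume_wall_le n hn
  refine ⟨C, fun K hKpos ε hε => ?_⟩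
  obtain ⟨A₁, hA₁, hwall⟩ := hC K hKpos
  -- Since `δ = R^{-1/2}`, the loss `δ ^ (-2bε)` is `R ^ (bε)`, which becomes `R ^ ε` after raising
  -- to the power `b⁻¹ = r'`.
  obtain ⟨A₂, hA₂, hkak⟩ := hK (2 * b * ε) (by positivity)
  set c : ℝ := (volume (Metric.ball (0 : EuclideanSpace ℝ (Fin n)) 1)).toReal * (1 / 2) ^ n / 4
    with hc
  have hcpos : 0 < c := by
    have : 0 < (volume (Metric.ball (0 : EuclideanSpace ℝ (Fin n)) 1)).toReal :=
      ENNReal.toReal_pos (Metric.measure_ball_pos _ _ one_pos).ne' measure_ball_lt_top.ne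
    positivity
  refine ⟨A₂ ^ b⁻¹ * A₁ / c * 3 ^ C, by positivity, ?_⟩
  intro R hR D Z hZ x₀ Ω hsep hball htan
  have hR0 : 0 < R := by linarith
  obtain ⟨p, hp, hpD, hpZ⟩ := hZ.exists_polynomial hn
  have hsq1 : 1 ≤ √R := Real.one_le_sqrt.2 hR
  have hsqR : √R * √R = R := Real.mul_self_sqrt hR0.le
  -- The wall bound has `(D + 2) ^ C` but the goal has `D ^ C`. For `D ≥ 1` the factor `3 ^ C`
  -- covers the difference; for `D = 0` the variety is empty and no tube is tangent to it.
  rcases Nat.eq_zero_or_pos D with hD | hD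
  · have hZe := eq_empty_of_zeros_of_totalDegree_eq_zero hp (by omega) hpZ
    have hΩ : Ω = ∅ := by
      refine Finset.eq_empty_of_forall_notMem fun T hT => ?_
      have := htan T hT (T.center_mem_carrier (Real.sqrt_nonneg R) hR0.le)
      simp [hZe] at this
    rw [hΩ, Finset.card_empty, Nat.cast_zero]
    positivity
  set W := Metric.thickening (K * √R) Z ∩ Metric.closedBall x₀ R with hW
  set w : ℝ := A₁ * ((D : ℝ) + 2) ^ C * R ^ ((n : ℝ) - 1 / 2) with hw
  have hw0 : 0 ≤ w := by positivity
  have hWw : volume W ≤ ENNReal.ofReal w := hwall R hR D p hp hpD Z hpZ x₀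
  have hTW : ∀ T ∈ Ω, T.carrier ⊆ W := fun T hT => Set.subset_inter (htan T hT) (hball T hT)
  set S : ℝ≥0∞ := ∑ T ∈ Ω, volume T.carrier with hS
  have hSfin : S ≠ ∞ := ENNReal.sum_ne_top.2 fun T hT =>
    ((measure_mono (hTW T hT)).trans_lt (hWw.trans_lt ENNReal.ofReal_lt_top)).ne
  set s : ℝ := S.toReal with hs
  have hs0 : 0 ≤ s := ENNReal.toReal_nonneg
  have hSs : S = ENNReal.ofReal s := (ENNReal.ofReal_toReal hSfin).symm
  have hδ : (√R)⁻¹ = √R / R := by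
    field_simp
    rw [sq, hsqR]
  set X : ℝ := A₂ * (√R)⁻¹ ^ (-(2 * b * ε)) * (√R)⁻¹ ^ ((n : ℝ) * a - ((n : ℝ) - 1)) with hX
  have hX0 : 0 ≤ X := by positivity
  have hupper : s ≤ X ^ b⁻¹ * w := by
    refine le_rpow_mul_of_le_mul_rpow hb0 hab hs0 hX0 hw0 ?_
    have h1 := sum_measure_le_eLpNorm_mul (μ := volume) Ω
      (fun T _ => T.isClosed_carrier.measurableSet) hTW hr.le
    have h2 := hkak (√R)⁻¹ (√R) R (by linarith) (by nlinarith) hδ Ω hsep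
    have h3 : volume W ^ (1 - (r⁻¹).toReal) ≤ ENNReal.ofReal (w ^ b) := by
      rw [← ha, show 1 - a = b by linarith, ← ENNReal.ofReal_rpow_of_nonneg hw0 hb0.le]
      exact ENNReal.rpow_le_rpow hWw hb0.le
    have h4 := h1.trans (mul_le_mul' h2 h3)
    rw [← hS, ← ha, hSs, ENNReal.ofReal_rpow_of_nonneg hs0 ENNReal.toReal_nonneg,
      ← ENNReal.ofReal_mul (by positivity), ← ENNReal.ofReal_mul (by positivity),
      ← ENNReal.ofReal_mul (by positivity), ENNReal.ofReal_le_ofReal_iff (by positivity)] at h4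
    refine h4.trans_eq ?_
    rw [hX]; ring
  have hlower : (Ω.card : ℝ) * (c * R ^ (((n : ℝ) + 1) / 2)) ≤ s := by
    have h1 : (Ω.card : ℝ≥0∞) * ENNReal.ofReal (c * R ^ (((n : ℝ) + 1) / 2)) ≤ S := by
      rw [← nsmul_eq_mul]
      exact Finset.card_nsmul_le_sum _ _ _ fun T _ => T.le_volume_carrier hR
    rw [hSs, ← ENNReal.ofReal_natCast, ← ENNReal.ofReal_mul (Nat.cast_nonneg _),
      ENNReal.ofReal_le_ofReal_iff hs0] at h1
    exact h1
  have hXR : X ^ b⁻¹ = A₂ ^ b⁻¹ * R ^ (ε - b⁻¹ / 2 + (n : ℝ) / 2) := by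
    rw [hX, sqrt_inv_rpow hR0.le, sqrt_inv_rpow hR0.le, mul_assoc, ← Real.rpow_add hR0,
      Real.mul_rpow hA₂.le (by positivity), ← Real.rpow_mul hR0.le]
    congr 2
    rw [show a = 1 - b by linarith]
    field_simp
    ring
  have hDC : ((D : ℝ) + 2) ^ C ≤ 3 ^ C * (D : ℝ) ^ C := by
    rw [← mul_pow]
    have : (1 : ℝ) ≤ D := by exact_mod_cast hD
    gcongr
    linarith
  have hpos : 0 < c * R ^ (((n : ℝ) + 1) / 2) := by positivity
  refine le_of_mul_le_mul_right (hlower.trans (hupper.trans ?_)) hpos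
  have hexp : R ^ (ε - b⁻¹ / 2 + (n : ℝ) / 2) * R ^ ((n : ℝ) - 1 / 2) =
      R ^ ε * R ^ ((n : ℝ) - 1 - r'.toReal / 2) * R ^ (((n : ℝ) + 1) / 2) := by
    rw [← Real.rpow_add hR0, ← Real.rpow_add hR0, ← Real.rpow_add hR0, hr'b]
    congr 1
    ring
  calc X ^ b⁻¹ * w = A₂ ^ b⁻¹ * A₁ * ((D : ℝ) + 2) ^ C *
        (R ^ (ε - b⁻¹ / 2 + (n : ℝ) / 2) * R ^ ((n : ℝ) - 1 / 2)) := by rw [hXR, hw]; ring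
    _ ≤ A₂ ^ b⁻¹ * A₁ * (3 ^ C * (D : ℝ) ^ C) *
        (R ^ (ε - b⁻¹ / 2 + (n : ℝ) / 2) * R ^ ((n : ℝ) - 1 / 2)) := by gcongr
    _ = _ := by
        rw [hexp]
        field_simp

/-- Only the endpoint `r = n / (n - 1)` is used: its conjugate exponent is `n`, and `n - 1 - n / 2 =
(n - 2) / 2`. -/
theorem KakeyaMaximalConjecture.tangentTubeConjecture {n : ℕ} (hn : 2 ≤ n)
    (h : KakeyaMaximalConjecture n) : TangentTubeConjecture n := by
  have hn' : (2 : ℝ) ≤ n := by exact_mod_cast hn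
  have hconj : ((n : ℝ) / ((n : ℝ) - 1)).HolderConjugate n := by
    refine Real.holderConjugate_iff.2 ⟨?_, ?_⟩
    · rw [lt_div_iff₀ (by linarith)]; linarith
    · rw [inv_div]; field_simp; ring
  have h1 := (h _ le_rfl).tangentTubeBound (by omega)
    (ENNReal.one_lt_ofReal.2 hconj.lt) hconj.ennrealOfReal
  rw [ENNReal.toReal_ofReal (by linarith)] at h1
  rw [TangentTubeConjecture]
  convert h1 using 1
  ring

theorem proposition2 (n : ℕ) (hn : 2 ≤ n) :
    (∀ r r' : ℝ≥0∞, 1 < r → r.HolderConjugate r' → KakeyaMaximalEstimate n r →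
      TangentTubeBound n ((n : ℝ) - 1 - r'.toReal / 2)) ∧
    (KakeyaMaximalConjecture n → TangentTubeConjecture n) :=
  ⟨fun _ _ hr hrr h => h.tangentTubeBound (by omega) hr hrr, fun h => h.tangentTubeConjecture hn⟩
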